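/- Let $E$ be a reflexive real Banach space, let $X\subseteq E$ be a sequentially weakly closed set, let $J,\Phi:X\to\mathbb R$ be two functions and let $a,b\in[-\infty,+\infty]$ with $a<b$. If $a\in\mathbb R$ (resp. $b\in\mathbb R$), let $M_a$ (resp. $M_b$) be the set of all global minimum points of $J+a\Phi$ (resp. $J+b\Phi$) in $X$; if $a=-\infty$ (resp. $b=+\infty$), let $M_a=\emptyset$ (resp. $M_b=\emptyset$). With the conventions $\inf\emptyset=+\infty$ and $\sup\emptyset=-\infty$, put $$\alpha:=\max\Big\{\inf_X\Phi,\ \sup_{M_b}\Phi\Big\},\qquad \beta:=\min\Big\{\sup_X\Phi,\ \inf_{M_a}\Phi\Big\}.$$ Assume that $\alpha<\beta$ and that, for each real $\lambda\in\,]a,b[$, the function $J+\lambda\Phi$ is sequentially weakly lower semicontinuous on $X$, has bounded sub-level sets $\{x\in X: J(x)+\lambda\Phi(x)\le\rho\}$ $(\rho\in\mathbb R)$, and has a unique global minimum point in $X$. Then, for each real $r\in\,]\alpha,\beta[$, the problem of minimizing $J$ over $\Phi^{-1}(r)$ is well-posed in the weak topology, that is, the restriction of $J$ to $\Phi^{-1}(r)$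 has a unique global minimum point $\hat x_r$, and every sequence $\{x_n\}$ in $\Phi^{-1}(r)$ with $\lim_{n\to\infty}J(x_n)=\inf_{\Phi^{-1}(r)}J$ converges weakly to $\hat x_r$. Moreover, the function $r\mapsto\hat x_r$ is continuous from $]\alpha,\beta[$ into $X$ with the weak topology, and the function $r\mapsto J(\hat x_r)$ is continuous in $]\alpha,\beta[$. -/

import Mathlib

open Set Filter Topology

namespace SaddleWellPosed

/-- A real normed space is reflexive if the canonical embedding into its bidual is onto. -/
def Reflexive (E : Type*) [NormedAddCommGroup E] [NormedSpace ℝ E] : Prop :=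
  Function.Surjective (NormedSpace.inclusionInDoubleDual ℝ E)

/-- Sequential lower semicontinuity of a real-valued function: if `u n → x`, then
`f x ≤ liminf f (u n)`, i.e. `f (u n)` is eventually above every `c < f x`. -/
def SeqLowerSemicontinuous {Y : Type*} [TopologicalSpace Y] (f : Y → ℝ) : Prop :=
  ∀ (u : ℕ → Y) (x : Y), Tendsto u atTop (𝓝 x) → ∀ c : ℝ, c < f x → ∀ᶠ n in atTop, c < f (u n)

/-- `x` is the unique global minimum point of the restriction of `f` to `C`. -/
def IsUniqueMinOn {Y : Type*} (f : Y → ℝ) (C : Set Y) (x : Y) : Prop :=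
  (x ∈ C ∧ IsMinOn f C x) ∧ ∀ y, y ∈ C ∧ IsMinOn f C y → y = x

/-- The problem of minimizing `f` over `C` is well-posed: `f` restricted to `C` has a unique
global minimum point, and every minimizing sequence in `C` converges to it.
(The infimum is attained by the first clause, hence it is a genuine one.) -/
def MinimizationWellPosed {Y : Type*} [TopologicalSpace Y] (f : Y → ℝ) (C : Set Y) : Prop :=
  ∃ x : Y, IsUniqueMinOn f C x ∧
    ∀ u : ℕ → Y, (∀ n, u n ∈ C) →
      Tendsto (fun n => f (u n)) atTop (𝓝 (sInf (f '' C))) → Tendsto u atTop (𝓝 x)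

/-- The set `M_c` of all global minimum points of `J + c Φ` if `c` is real;
it is empty if `c` is infinite. -/
def globalMinima {Y : Type*} (J Φ : Y → ℝ) (c : EReal) : Set Y :=
  {x | ∃ t : ℝ, c = (t : EReal) ∧ ∀ y, J x + t * Φ x ≤ J y + t * Φ y}

/-- `α = max {inf_Y Φ, sup_{M_b} Φ}`, in the extended reals. -/
noncomputable def alpha {Y : Type*} (J Φ : Y → ℝ) (b : EReal) : EReal :=
  max (⨅ x : Y, (Φ x : EReal)) (⨆ x ∈ globalMinima J Φ b, (Φ x : EReal))

/-- `β = min {sup_Y Φ, inf_{M_a} Φ}`, in the extended reals. -/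
noncomputable def beta {Y : Type*} (J Φ : Y → ℝ) (a : EReal) : EReal :=
  min (⨆ x : Y, (Φ x : EReal)) (⨅ x ∈ globalMinima J Φ a, (Φ x : EReal))

end SaddleWellPosed

/-! For real `t` in ]a,b[ let x_t minimize `J + t Φ`. On the fiber of `Φ` through x_t, `J` and `J +
t Φ` differ by a constant, so x_t solves the constrained problem there, and uniqueness and
well-posedness pass to it. Each `r` in ]α,β[ is the level of some x_t: t ↦ Φ(x_t) is continuous
(`tendsto_constraint`), the definitions of α and β give values ≤ r and ≥ r (`exists_min_le`,
`exists_min_ge`), and the intermediate value theorem applies. For continuity in `r`, monotonicity of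
t ↦ Φ(x_t) confines the multipliers to a compact subinterval of ]a,b[. The main tool is
`exists_subseq_tendsto_min`, stability of minimizers as the parameter varies. -/

namespace SaddleWellPosed

/-! ### Weak sequential compactness in reflexive spaces. -/

section WeakCompactness

variable {E : Type*} [NormedAddCommGroup E] [NormedSpace ℝ E]

/-- In a reflexive space the weak closure of a norm-bounded set is weakly compact. -/
theorem Reflexive.isCompact_closure (hE : Reflexive E) {S : Set E}
    (hS : Bornology.IsBounded S) : IsCompact (closure (toWeakSpace ℝ E '' S)) := by
  have hsurj : Set.range (NormedSpace.inclusionInDoubleDualWeak ℝ E) = Set.univ := by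
    refine Set.eq_univ_of_forall fun ξ => ?_
    obtain ⟨x, hx⟩ := hE (WeakDual.toStrongDual ξ)
    exact ⟨toWeakSpace ℝ E x, hx⟩
  refine NormedSpace.isCompact_closure_of_isBounded ℝ E _ ?_ (hsurj ▸ Set.subset_univ _)
  rwa [Set.preimage_image_eq _ (toWeakSpace ℝ E).injective]

/-- A separable subspace of a normed space is separated by countably many functionals. -/
theorem exists_seq_separating {F : Submodule ℝ E} (hF : TopologicalSpace.IsSeparable (F : Set E)) :
    ∃ f : ℕ → StrongDual ℝ E, ∀ x ∈ F, ∀ y ∈ F, x ≠ y → ∃ n, f n x ≠ f n y := by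
  have : TopologicalSpace.SeparableSpace F := hF.separableSpace
  choose f hf1 hf2 using fun n : ℕ =>
    exists_dual_vector'' ℝ ((TopologicalSpace.denseSeq F n : F) : E)
  refine ⟨f, fun x hx y hy hxy => ?_⟩
  have hz : 0 < ‖x - y‖ := norm_pos_iff.2 (sub_ne_zero.2 hxy)
  obtain ⟨n, hn⟩ := (TopologicalSpace.denseRange_denseSeq F).exists_dist_lt
    (⟨x - y, F.sub_mem hx hy⟩ : F) (half_pos hz)
  set d : E := ((TopologicalSpace.denseSeq F n : F) : E)
  have hd : ‖x - y - d‖ < ‖x - y‖ / 2 := by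
    rw [← dist_eq_norm]; exact hn
  refine ⟨n, fun h => ?_⟩
  -- `f n` norms `d`; if it killed `x - y`, then ‖d‖ ≤ ‖x - y - d‖ < ‖x - y‖ / 2, against the
  -- triangle inequality.
  have h1 : f n (x - y - d) = -‖d‖ := by
    have := hf2 n
    simp only [map_sub, h, sub_self, zero_sub]
    simpa using this
  have h2 : ‖f n (x - y - d)‖ ≤ ‖x - y - d‖ := by
    simpa using (f n).le_of_opNorm_le (hf1 n) (x - y - d)
  rw [h1, norm_neg, norm_norm] at h2
  have h3 : ‖x - y‖ ≤ ‖x - y - d‖ + ‖d‖ := by simpa using norm_add_le (x - y - d) d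
  linarith

/-- Bounded sequences in a reflexive space have weakly convergent subsequences. -/
theorem Reflexive.exists_subseq_tendsto (hE : Reflexive E) {u : ℕ → E}
    (hu : Bornology.IsBounded (Set.range u)) :
    ∃ (x : WeakSpace ℝ E) (φ : ℕ → ℕ), StrictMono φ ∧
      Tendsto (fun n => toWeakSpace ℝ E (u (φ n))) atTop (𝓝 x) := by
  set K := closure (toWeakSpace ℝ E '' Set.range u) with hKdef
  have hK : IsCompact K := hE.isCompact_closure hu
  set F := (Submodule.span ℝ (Set.range u)).topologicalClosure with hFdef
  have hFsep : TopologicalSpace.IsSeparable (F : Set E) :=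
    ((Set.countable_range u).isSeparable.span (R := ℝ)).closure
  obtain ⟨f, hf⟩ := exists_seq_separating hFsep
  -- Mazur: the weak and norm closures of a convex set agree. So the `f n` separate `K`, which is
  -- therefore metrizable.
  have hKF : ∀ w ∈ K, (toWeakSpace ℝ E).symm w ∈ F := by
    intro w hw
    have h1 : w ∈ closure (toWeakSpace ℝ E '' (Submodule.span ℝ (Set.range u) : Set E)) :=
      closure_mono (Set.image_mono Submodule.subset_span) hw
    rw [← (Submodule.convex _).toWeakSpace_closure ℝ] at h1
    obtain ⟨x, hx, rfl⟩ := h1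
    exact hx
  have : CompactSpace K := isCompact_iff_compactSpace.mp hK
  have : TopologicalSpace.MetrizableSpace K :=
    Metric.PiNatEmbed.TopologicalSpace.MetrizableSpace.of_countable_separating
      (fun n (k : K) => f n ((toWeakSpace ℝ E).symm k))
      (fun n => (WeakBilin.eval_continuous (topDualPairing ℝ E).flip (f n)).comp
        continuous_subtype_val)
      (fun x y hxy => hf _ (hKF x x.2) _ (hKF y y.2) fun h =>
        hxy (Subtype.ext ((toWeakSpace ℝ E).symm.injective h)))
  let v : ℕ → K := fun n =>
    ⟨toWeakSpace ℝ E (u n), subset_closure (Set.mem_image_of_mem _ (Set.mem_range_self n))⟩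
  obtain ⟨x, φ, hφ, hx⟩ := CompactSpace.tendsto_subseq v
  exact ⟨x, φ, hφ, (continuous_subtype_val.tendsto x).comp hx⟩

end WeakCompactness

theorem exists_real_left {a : EReal} {t : ℝ} (h1 : a < (t : EReal)) :
    ∃ c : ℝ, a < (c : EReal) ∧ c < t := by
  obtain ⟨c, hc1, hc2⟩ := EReal.lt_iff_exists_real_btwn.1 h1
  exact ⟨c, hc1, EReal.coe_lt_coe_iff.1 hc2⟩

/-! ### Minimizers of `J + t Φ` and their dependence on `t`. -/

section Pencil

variable {Y : Type*} [TopologicalSpace Y] {J Φ : Y → ℝ} {a b : EReal}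

/-- The functions `J + t Φ`, for `t` between `a` and `b`, are sequentially lower semicontinuous,
have relatively sequentially compact sub-level sets and a unique global minimum point. -/
structure RegularPencil (J Φ : Y → ℝ) (a b : EReal) : Prop where
  lsc : ∀ t : ℝ, a < (t : EReal) → (t : EReal) < b →
    SeqLowerSemicontinuous (fun x => J x + t * Φ x)
  exists_subseq_tendsto : ∀ t : ℝ, a < (t : EReal) → (t : EReal) < b →
    ∀ (ρ : ℝ) (u : ℕ → Y), (∀ n, J (u n) + t * Φ (u n) ≤ ρ) →
      ∃ (x : Y) (φ : ℕ → ℕ), StrictMono φ ∧ Tendsto (u ∘ φ) atTop (𝓝 x)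
  exists_isUniqueMinOn : ∀ t : ℝ, a < (t : EReal) → (t : EReal) < b →
    ∃ x : Y, IsUniqueMinOn (fun y => J y + t * Φ y) Set.univ x

/-- Global minimum points of `J + t Φ`. -/
def IsPencilMin (J Φ : Y → ℝ) (t : ℝ) (x : Y) : Prop :=
  ∀ y, J x + t * Φ x ≤ J y + t * Φ y

omit [TopologicalSpace Y] in
theorem IsPencilMin.neg {t : ℝ} {x : Y} (h : IsPencilMin J Φ t x) :
    IsPencilMin J (fun y => -Φ y) (-t) x := fun y => by
  simpa using h y

-- Adding the two minimality inequalities gives (t - s)(Φ y - Φ x) ≤ 0.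
omit [TopologicalSpace Y] in
theorem IsPencilMin.antitone {s t : ℝ} {x y : Y}
    (hx : IsPencilMin J Φ s x) (hy : IsPencilMin J Φ t y) (h : Φ x < Φ y) : t ≤ s := by
  have h1 := hx y
  have h2 := hy x
  nlinarith

namespace RegularPencil

/-- This symmetry lets each one-sided estimate be proved only once. -/
theorem neg (h : RegularPencil J Φ a b) : RegularPencil J (fun y => -Φ y) (-b) (-a) := by
  have key : ∀ t : ℝ, -b < (t : EReal) → (t : EReal) < -a →
      a < ((-t : ℝ) : EReal) ∧ ((-t : ℝ) : EReal) < b := fun t h1 h2 => by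
    rw [EReal.coe_neg]
    exact ⟨EReal.lt_neg_comm.1 h2, EReal.neg_lt_comm.1 h1⟩
  constructor
  · intro t h1 h2
    simpa using h.lsc (-t) (key t h1 h2).1 (key t h1 h2).2
  · intro t h1 h2 ρ u hu
    exact h.exists_subseq_tendsto (-t) (key t h1 h2).1 (key t h1 h2).2 ρ u
      (by simpa using hu)
  · intro t h1 h2
    simpa using h.exists_isUniqueMinOn (-t) (key t h1 h2).1 (key t h1 h2).2

theorem exists_min (h : RegularPencil J Φ a b) {t : ℝ} (h1 : a < (t : EReal))
    (h2 : (t : EReal) < b) : ∃ x, IsPencilMin J Φ t x := by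
  obtain ⟨x, hx, -⟩ := h.exists_isUniqueMinOn t h1 h2
  exact ⟨x, fun y => hx.2 (Set.mem_univ y)⟩

theorem min_unique (h : RegularPencil J Φ a b) {t : ℝ} (h1 : a < (t : EReal))
    (h2 : (t : EReal) < b) {x y : Y} (hx : IsPencilMin J Φ t x) (hy : IsPencilMin J Φ t y) :
    x = y := by
  obtain ⟨z, -, hz⟩ := h.exists_isUniqueMinOn t h1 h2
  rw [hz x ⟨Set.mem_univ _, fun w _ => hx w⟩, hz y ⟨Set.mem_univ _, fun w _ => hy w⟩]

/-- Minimum points of `J + s n Φ` along which `Φ ≥ m` subconverge to a minimum point of the limit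
function, also when `lim s n` is the right end point. -/
theorem exists_subseq_tendsto_min (h : RegularPencil J Φ a b) {s : ℕ → ℝ} {t c m : ℝ}
    (hs : Tendsto s atTop (𝓝 t)) (hac : a < (c : EReal)) (hct : c < t) (htb : (t : EReal) ≤ b)
    {x : ℕ → Y} (hx : ∀ n, IsPencilMin J Φ (s n) (x n)) (hm : ∀ᶠ n in atTop, m ≤ Φ (x n)) :
    ∃ (z : Y) (φ : ℕ → ℕ), StrictMono φ ∧ Tendsto (x ∘ φ) atTop (𝓝 z) ∧
      IsPencilMin J Φ t z ∧ m ≤ Φ z := by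
  have hin : ∀ μ : ℝ, c ≤ μ → μ < t → a < (μ : EReal) ∧ (μ : EReal) < b := fun μ h1 h2 =>
    ⟨hac.trans_le (EReal.coe_le_coe_iff.2 h1), (EReal.coe_lt_coe_iff.2 h2).trans_le htb⟩
  -- Split J + μΦ = (J + s n Φ) + (μ - s n)Φ; eventually μ < s n, so Φ ≥ m bounds the last term
  -- above. Semicontinuity is needed only at μ < t, which is why t = b is allowed.
  have hupper : ∀ μ < t, ∀ y, ∀ᶠ n in atTop,
      J (x n) + μ * Φ (x n) ≤ J y + s n * Φ y + (μ - s n) * m := by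
    intro μ hμ y
    filter_upwards [hm, hs.eventually (lt_mem_nhds hμ)] with n hn1 hn2
    have := hx n y
    nlinarith
  have hlim : ∀ μ y, Tendsto (fun n => J y + s n * Φ y + (μ - s n) * m) atTop
      (𝓝 (J y + t * Φ y + (μ - t) * m)) := fun μ y =>
    (tendsto_const_nhds.add (hs.mul_const _)).add ((tendsto_const_nhds.sub hs).mul_const _)
  obtain ⟨N, hN⟩ := eventually_atTop.1 ((hupper c hct (x 0)).and
    ((hlim c (x 0)).eventually (gt_mem_nhds (lt_add_one _))))
  obtain ⟨z, ψ, hψ, hz⟩ := h.exists_subseq_tendsto c (hin c le_rfl hct).1 (hin c le_rfl hct).2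
    _ (fun n => x (n + N))
    (fun n => (hN (n + N) (Nat.le_add_left _ _)).1.trans (hN (n + N) (Nat.le_add_left _ _)).2.le)
  have hφ : StrictMono fun n => ψ n + N := fun i j hij => Nat.add_lt_add_right (hψ hij) N
  have hz' : Tendsto (fun n => x (ψ n + N)) atTop (𝓝 z) := hz
  have hbound : ∀ μ, c ≤ μ → μ < t → ∀ y, J z + μ * Φ z ≤ J y + t * Φ y + (μ - t) * m := by
    intro μ h1 h2 y
    refine le_of_forall_lt fun e he => ?_
    obtain ⟨e', he', he''⟩ := exists_between he
    refine he'.trans_le (ge_of_tendsto ((hlim μ y).comp hφ.tendsto_atTop) ?_)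
    filter_upwards [h.lsc μ (hin μ h1 h2).1 (hin μ h1 h2).2 _ z hz' e' he'',
      hφ.tendsto_atTop.eventually (hupper μ h2 y)] with n hn1 hn2
    exact hn1.le.trans hn2
  refine ⟨z, _, hφ, hz', fun y => ?_, ?_⟩
  · have h1 : Tendsto (fun μ : ℝ => J z + μ * Φ z) (𝓝[<] t) (𝓝 (J z + t * Φ z)) :=
      tendsto_nhdsWithin_of_tendsto_nhds (by
        have : Continuous fun μ : ℝ => J z + μ * Φ z := by fun_prop
        exact this.tendsto t)
    have h2 : Tendsto (fun μ : ℝ => J y + t * Φ y + (μ - t) * m) (𝓝[<] t)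
        (𝓝 (J y + t * Φ y)) :=
      tendsto_nhdsWithin_of_tendsto_nhds (by
        have : Continuous fun μ : ℝ => J y + t * Φ y + (μ - t) * m := by fun_prop
        simpa using this.tendsto t)
    refine le_of_tendsto_of_tendsto h1 h2 ?_
    filter_upwards [Ioo_mem_nhdsLT hct] with μ hμ
    exact hbound μ hμ.1.le hμ.2 y
  -- With y = z the bound reads (c - t)(Φ z - m) ≤ 0, and c < t.
  · have := hbound c le_rfl hct z
    nlinarith

theorem eventually_lt_of_min (h : RegularPencil J Φ a b) {s : ℕ → ℝ} {t : ℝ}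
    (hs : Tendsto s atTop (𝓝 t)) (h1 : a < (t : EReal)) (h2 : (t : EReal) < b) {x : ℕ → Y}
    (hx : ∀ n, IsPencilMin J Φ (s n) (x n)) {z : Y} (hz : IsPencilMin J Φ t z) {m : ℝ}
    (hm : Φ z < m) : ∀ᶠ n in atTop, Φ (x n) < m := by
  by_contra hcon
  obtain ⟨φ, hφ, hφm⟩ := extraction_of_frequently_atTop (not_eventually.1 hcon)
  obtain ⟨c, hc1, hc2⟩ := exists_real_left h1
  obtain ⟨w, -, -, -, hw, hmw⟩ := h.exists_subseq_tendsto_min (hs.comp hφ.tendsto_atTop) hc1 hc2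
    h2.le (x := x ∘ φ) (m := m) (fun n => hx (φ n)) (Eventually.of_forall fun n => not_lt.1 (hφm n))
  rw [h.min_unique h1 h2 hw hz] at hmw
  exact absurd hm (not_lt.2 hmw)

theorem tendsto_constraint (h : RegularPencil J Φ a b) {s : ℕ → ℝ} {t : ℝ}
    (hs : Tendsto s atTop (𝓝 t)) (h1 : a < (t : EReal)) (h2 : (t : EReal) < b) {x : ℕ → Y}
    (hx : ∀ n, IsPencilMin J Φ (s n) (x n)) {z : Y} (hz : IsPencilMin J Φ t z) :
    Tendsto (fun n => Φ (x n)) atTop (𝓝 (Φ z)) := by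
  refine tendsto_order.2 ⟨fun m hm => ?_, fun m hm => h.eventually_lt_of_min hs h1 h2 hx hz hm⟩
  have := h.neg.eventually_lt_of_min hs.neg (t := -t) (x := x) (z := z) (m := -m)
    (by rw [EReal.coe_neg]; exact EReal.neg_lt_neg_iff.2 h2)
    (by rw [EReal.coe_neg]; exact EReal.neg_lt_neg_iff.2 h1)
    (fun n => (hx n).neg) hz.neg (neg_lt_neg hm)
  simpa using this

theorem tendsto_objective (h : RegularPencil J Φ a b) {s : ℕ → ℝ} {t : ℝ}
    (hs : Tendsto s atTop (𝓝 t)) (h1 : a < (t : EReal)) (h2 : (t : EReal) < b) {x : ℕ → Y}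
    (hx : ∀ n, IsPencilMin J Φ (s n) (x n)) {z : Y} (hz : IsPencilMin J Φ t z) :
    Tendsto (fun n => J (x n)) atTop (𝓝 (J z)) := by
  have hΦ := h.tendsto_constraint hs h1 h2 hx hz
  have hl : Tendsto (fun n => J z + t * Φ z - t * Φ (x n)) atTop (𝓝 (J z)) := by
    simpa using (tendsto_const_nhds (x := J z + t * Φ z)).sub (hΦ.const_mul t)
  have hu : Tendsto (fun n => J z + s n * Φ z - s n * Φ (x n)) atTop (𝓝 (J z)) := by
    simpa using ((tendsto_const_nhds (x := J z)).add (hs.mul_const (Φ z))).sub (hs.mul hΦ)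
  -- The lower bound is minimality of `z` at `t`, the upper one minimality of `x n` at `s n`.
  refine tendsto_of_tendsto_of_tendsto_of_le_of_le hl hu (fun n => ?_) (fun n => ?_)
  · have := hz (x n)
    dsimp only
    linarith
  · have := hx n z
    dsimp only
    linarith

theorem tendsto_min (h : RegularPencil J Φ a b) {s : ℕ → ℝ} {t : ℝ}
    (hs : Tendsto s atTop (𝓝 t)) (h1 : a < (t : EReal)) (h2 : (t : EReal) < b) {x : ℕ → Y}
    (hx : ∀ n, IsPencilMin J Φ (s n) (x n)) {z : Y} (hz : IsPencilMin J Φ t z) :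
    Tendsto x atTop (𝓝 z) := by
  refine tendsto_of_subseq_tendsto fun ns hns => ?_
  obtain ⟨c, hc1, hc2⟩ := exists_real_left h1
  obtain ⟨w, φ, -, hφ, hw, -⟩ := h.exists_subseq_tendsto_min (hs.comp hns) hc1 hc2
    h2.le (x := x ∘ ns) (m := Φ z - 1) (fun n => hx (ns n))
    (((h.tendsto_constraint hs h1 h2 hx hz).comp hns).eventually
      (lt_mem_nhds (sub_one_lt _)) |>.mono fun n hn => hn.le)
  rw [h.min_unique h1 h2 hw hz] at hφ
  exact ⟨φ, hφ⟩

/-- If `r` lies above `inf Φ` and above `Φ` on the minimum points at the right end point, then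
some minimum point of the pencil satisfies `Φ ≤ r`. -/
theorem exists_min_le (h : RegularPencil J Φ a b) (hab : a < b) {r : ℝ} (hr : ∃ y, Φ y < r)
    (hb : ∀ t : ℝ, b = (t : EReal) → ∀ x, IsPencilMin J Φ t x → Φ x < r) :
    ∃ t : ℝ, a < (t : EReal) ∧ (t : EReal) < b ∧ ∃ x, IsPencilMin J Φ t x ∧ Φ x ≤ r := by
  by_contra! hcon
  obtain ⟨c, hac, hcb⟩ := EReal.lt_iff_exists_real_btwn.1 hab
  induction b with
  | bot => exact absurd hcb not_lt_bot
  | coe t =>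
    have hct : c < t := EReal.coe_lt_coe_iff.1 hcb
    obtain ⟨s, -, hs, hst⟩ := exists_seq_strictMono_tendsto' hct
    have hin : ∀ n, a < (s n : EReal) ∧ (s n : EReal) < (t : EReal) := fun n =>
      ⟨hac.trans (EReal.coe_lt_coe_iff.2 (hs n).1), EReal.coe_lt_coe_iff.2 (hs n).2⟩
    choose x hx using fun n => h.exists_min (hin n).1 (hin n).2
    obtain ⟨z, -, -, -, hz, hrz⟩ := h.exists_subseq_tendsto_min hst hac hct le_rfl hx
      (Eventually.of_forall fun n => (hcon (s n) (hin n).1 (hin n).2 (x n) (hx n)).le)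
    exact absurd (hb t rfl z hz) (not_lt.2 hrz)
  | top =>
    obtain ⟨y, hy⟩ := hr
    obtain ⟨w, hw⟩ := h.exists_min hac hcb
    have hD : 0 ≤ J y + c * Φ y - (J w + c * Φ w) := sub_nonneg.2 (hw y)
    set D := J y + c * Φ y - (J w + c * Φ w) with hDdef
    -- Minimality of `x` at `t` and of `w` at `c` give (t - c)(Φ x - Φ y) ≤ D; this `t` makes Φ x >
    -- r impossible.
    set t := c + (D + 1) / (r - Φ y) with ht
    have hry : 0 < r - Φ y := sub_pos.2 hy
    have htc : 0 < t - c := by rw [ht, add_sub_cancel_left]; positivity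
    have hin : a < (t : EReal) := hac.trans (EReal.coe_lt_coe_iff.2 (sub_pos.1 htc))
    obtain ⟨x, hx⟩ := h.exists_min hin (EReal.coe_lt_top t)
    have hrx := hcon t hin (EReal.coe_lt_top t) x hx
    have h1 : (t - c) * (r - Φ y) = D + 1 := by
      rw [ht, add_sub_cancel_left, div_mul_cancel₀ _ hry.ne']
    have h2 := hx y
    have h3 := hw x
    nlinarith

theorem exists_min_ge (h : RegularPencil J Φ a b) (hab : a < b) {r : ℝ} (hr : ∃ y, r < Φ y)
    (ha : ∀ t : ℝ, a = (t : EReal) → ∀ x, IsPencilMin J Φ t x → r < Φ x) :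
    ∃ t : ℝ, a < (t : EReal) ∧ (t : EReal) < b ∧ ∃ x, IsPencilMin J Φ t x ∧ r ≤ Φ x := by
  obtain ⟨t, h1, h2, x, hx, hrx⟩ := h.neg.exists_min_le (EReal.neg_lt_neg_iff.2 hab) (r := -r)
    (hr.imp fun y hy => neg_lt_neg hy) (fun t ht x hx => neg_lt_neg (ha (-t)
      (by rw [EReal.coe_neg, ← ht, neg_neg]) x (by simpa using hx.neg)))
  refine ⟨-t, ?_, ?_, x, by simpa using hx.neg, neg_le_neg_iff.1 hrx⟩
  · rw [EReal.coe_neg]; exact EReal.lt_neg_comm.1 h2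
  · rw [EReal.coe_neg]; exact EReal.neg_lt_comm.1 h1

theorem exists_min_eq (h : RegularPencil J Φ a b) (hab : a < b) {r : ℝ}
    (hr1 : ∃ y, Φ y < r) (hr2 : ∃ y, r < Φ y)
    (ha : ∀ t : ℝ, a = (t : EReal) → ∀ x, IsPencilMin J Φ t x → r < Φ x)
    (hb : ∀ t : ℝ, b = (t : EReal) → ∀ x, IsPencilMin J Φ t x → Φ x < r) :
    ∃ t : ℝ, a < (t : EReal) ∧ (t : EReal) < b ∧ ∃ x, IsPencilMin J Φ t x ∧ Φ x = r := by
  obtain ⟨t₁, ht₁a, ht₁b, x₁, hx₁, hr₁⟩ := h.exists_min_le hab hr1 hb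
  obtain ⟨t₂, ht₂a, ht₂b, x₂, hx₂, hr₂⟩ := h.exists_min_ge hab hr2 ha
  let I : Set ℝ := {t | a < (t : EReal) ∧ (t : EReal) < b}
  have hI : I.OrdConnected := ⟨fun p hp q hq t ht =>
    ⟨hp.1.trans_le (EReal.coe_le_coe_iff.2 ht.1), (EReal.coe_le_coe_iff.2 ht.2).trans_lt hq.2⟩⟩
  choose S hS using fun t : I => h.exists_min t.2.1 t.2.2
  have hcont : Continuous fun t : I => Φ (S t) :=
    continuous_iff_seqContinuous.2 fun s t hs =>
      h.tendsto_constraint ((continuous_subtype_val.tendsto t).comp hs) t.2.1 t.2.2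
        (fun n => hS (s n)) (hS t)
  have : PreconnectedSpace I := Subtype.preconnectedSpace hI.isPreconnected
  rw [h.min_unique ht₁a ht₁b hx₁ (hS ⟨t₁, ht₁a, ht₁b⟩)] at hr₁
  rw [h.min_unique ht₂a ht₂b hx₂ (hS ⟨t₂, ht₂a, ht₂b⟩)] at hr₂
  obtain ⟨t, ht⟩ := mem_range_of_exists_le_of_exists_ge hcont ⟨_, hr₁⟩ ⟨_, hr₂⟩
  exact ⟨t, t.2.1, t.2.2, S t, hS t, ht⟩

theorem isUniqueMinOn_fiber (h : RegularPencil J Φ a b) {t : ℝ} (h1 : a < (t : EReal))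
    (h2 : (t : EReal) < b) {x : Y} (hx : IsPencilMin J Φ t x) :
    IsUniqueMinOn J (Φ ⁻¹' {Φ x}) x := by
  have hle : ∀ y, Φ y = Φ x → J x ≤ J y := fun y hy => by simpa [hy] using hx y
  refine ⟨⟨rfl, fun y hy => hle y hy⟩, fun y hy => h.min_unique h1 h2 (fun w => ?_) hx⟩
  have hJ : J y ≤ J x := hy.2 (show x ∈ Φ ⁻¹' {Φ x} from rfl)
  have hΦ : Φ y = Φ x := hy.1
  rw [hΦ]
  linarith [hx w]

theorem minimizationWellPosed_fiber (h : RegularPencil J Φ a b) {t : ℝ} (h1 : a < (t : EReal))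
    (h2 : (t : EReal) < b) {x : Y} (hx : IsPencilMin J Φ t x) :
    MinimizationWellPosed J (Φ ⁻¹' {Φ x}) := by
  have hU := h.isUniqueMinOn_fiber h1 h2 hx
  refine ⟨x, hU, fun u hu hlim => ?_⟩
  have hinf : sInf (J '' (Φ ⁻¹' {Φ x})) = J x :=
    IsLeast.csInf_eq ⟨Set.mem_image_of_mem _ hU.1.1, by rintro _ ⟨y, hy, rfl⟩; exact hU.1.2 hy⟩
  rw [hinf] at hlim
  refine tendsto_of_subseq_tendsto fun ns hns => ?_
  have hv : Tendsto (fun n => J (u (ns n)) + t * Φ x) atTop (𝓝 (J x + t * Φ x)) :=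
    (hlim.comp hns).add_const _
  have hΦ : ∀ n, Φ (u n) = Φ x := hu
  obtain ⟨ρ, hρ⟩ := hv.bddAbove_range
  obtain ⟨z, φ, hφ, hz⟩ := h.exists_subseq_tendsto t h1 h2 ρ (u ∘ ns) fun n => by
    simpa [hΦ] using hρ (Set.mem_range_self n)
  -- `Φ` need not be continuous, so `z` is not known to lie in the fiber; it is identified as a
  -- minimizer of `J + t Φ` instead.
  have hzx : z = x := h.min_unique h1 h2 (fun y => (le_of_forall_lt fun e he => by
    obtain ⟨e', he', he''⟩ := exists_between he
    refine he'.trans_le (ge_of_tendsto (hv.comp hφ.tendsto_atTop) ?_)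
    filter_upwards [h.lsc t h1 h2 _ z hz e' he''] with n hn
    simpa [hΦ] using hn.le).trans (hx y)) hx
  exact ⟨φ, hzx ▸ hz⟩

end RegularPencil

omit [TopologicalSpace Y] in
theorem exists_lt_of_alpha_lt {r : ℝ} (hr : alpha J Φ b < (r : EReal)) :
    (∃ y, Φ y < r) ∧ ∀ t : ℝ, b = (t : EReal) → ∀ x, IsPencilMin J Φ t x → Φ x < r := by
  obtain ⟨h1, h2⟩ := max_lt_iff.1 hr
  obtain ⟨y, hy⟩ := iInf_lt_iff.1 h1
  refine ⟨⟨y, EReal.coe_lt_coe_iff.1 hy⟩, fun t ht x hx => EReal.coe_lt_coe_iff.1 ?_⟩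
  exact (le_iSup₂_of_le (f := fun (x : Y) (_ : x ∈ globalMinima J Φ b) => (Φ x : EReal))
    x ⟨t, ht, hx⟩ le_rfl).trans_lt h2

omit [TopologicalSpace Y] in
theorem exists_gt_of_lt_beta {r : ℝ} (hr : (r : EReal) < beta J Φ a) :
    (∃ y, r < Φ y) ∧ ∀ t : ℝ, a = (t : EReal) → ∀ x, IsPencilMin J Φ t x → r < Φ x := by
  obtain ⟨h1, h2⟩ := lt_min_iff.1 hr
  obtain ⟨y, hy⟩ := lt_iSup_iff.1 h1
  refine ⟨⟨y, EReal.coe_lt_coe_iff.1 hy⟩, fun t ht x hx => EReal.coe_lt_coe_iff.1 ?_⟩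
  exact h2.trans_le (iInf₂_le_of_le (f := fun (x : Y) (_ : x ∈ globalMinima J Φ a) =>
    (Φ x : EReal)) x ⟨t, ht, hx⟩ le_rfl)

/-- Well-posedness of the constrained problems, and continuous dependence on the level, for a
regular pencil. -/
theorem RegularPencil.wellPosed (h : RegularPencil J Φ a b) (hab : a < b) :
    (∀ r : ℝ, alpha J Φ b < (r : EReal) → (r : EReal) < beta J Φ a →
      MinimizationWellPosed J (Φ ⁻¹' {r})) ∧
    ∃ xhat : {r : ℝ // alpha J Φ b < (r : EReal) ∧ (r : EReal) < beta J Φ a} → Y,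
      (∀ r, IsUniqueMinOn J (Φ ⁻¹' {r.val}) (xhat r)) ∧
      Continuous xhat ∧ Continuous (fun r => J (xhat r)) := by
  have key : ∀ r : {r : ℝ // alpha J Φ b < (r : EReal) ∧ (r : EReal) < beta J Φ a},
      ∃ t : ℝ, a < (t : EReal) ∧ (t : EReal) < b ∧ ∃ x, IsPencilMin J Φ t x ∧ Φ x = r :=
    fun r => h.exists_min_eq hab (exists_lt_of_alpha_lt r.2.1).1 (exists_gt_of_lt_beta r.2.2).1
      (exists_gt_of_lt_beta r.2.2).2 (exists_lt_of_alpha_lt r.2.1).2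
  choose τ hτa hτb xhat hmin hval using key
  have huniq : ∀ r, IsUniqueMinOn J (Φ ⁻¹' {r.val}) (xhat r) := fun r => by
    have := h.isUniqueMinOn_fiber (hτa r) (hτb r) (hmin r)
    rwa [hval r] at this
  have hlim : ∀ (ρ : ℕ → {r : ℝ // alpha J Φ b < (r : EReal) ∧ (r : EReal) < beta J Φ a}) r,
      Tendsto ρ atTop (𝓝 r) →
        Tendsto (fun n => (xhat (ρ n), J (xhat (ρ n)))) atTop (𝓝 (xhat r, J (xhat r))) := by
    intro ρ r hρ
    have hρ' : Tendsto (fun n => (ρ n : ℝ)) atTop (𝓝 (r : ℝ)) :=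
      (continuous_subtype_val.tendsto r).comp hρ
    obtain ⟨p, hp1, hp2⟩ := EReal.lt_iff_exists_real_btwn.1 r.2.1
    obtain ⟨q, hq1, hq2⟩ := EReal.lt_iff_exists_real_btwn.1 r.2.2
    let p' : {r : ℝ // alpha J Φ b < (r : EReal) ∧ (r : EReal) < beta J Φ a} :=
      ⟨p, hp1, hp2.trans r.2.2⟩
    let q' : {r : ℝ // alpha J Φ b < (r : EReal) ∧ (r : EReal) < beta J Φ a} :=
      ⟨q, r.2.1.trans hq1, hq2⟩
    refine tendsto_of_subseq_tendsto fun ns hns => ?_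
    -- `τ` is an arbitrary choice of multipliers, with no continuity claimed; trapping it between
    -- levels p < r < q supplies cluster points inside ]a,b[.
    have hmem : ∀ᶠ n in atTop, τ (ρ (ns n)) ∈ Set.Icc (τ q') (τ p') := by
      filter_upwards [(hρ'.comp hns).eventually (lt_mem_nhds (EReal.coe_lt_coe_iff.1 hp2)),
        (hρ'.comp hns).eventually (gt_mem_nhds (EReal.coe_lt_coe_iff.1 hq1))] with n hn1 hn2
      exact ⟨(hmin _).antitone (hmin q') (by rw [hval, hval]; exact hn2),
        (hmin p').antitone (hmin _) (by rw [hval, hval]; exact hn1)⟩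
    obtain ⟨t, ht, φ, hφ, hφt⟩ := isCompact_Icc.isSeqCompact.subseq_of_frequently_in
      hmem.frequently
    have hta : a < (t : EReal) := (hτa q').trans_le (EReal.coe_le_coe_iff.2 ht.1)
    have htb : (t : EReal) < b := (EReal.coe_le_coe_iff.2 ht.2).trans_lt (hτb p')
    obtain ⟨z, hz⟩ := h.exists_min hta htb
    have hxφ : ∀ n, IsPencilMin J Φ (τ (ρ (ns (φ n)))) (xhat (ρ (ns (φ n)))) := fun n => hmin _
    have hΦz : Φ z = r := by
      refine tendsto_nhds_unique (h.tendsto_constraint hφt hta htb hxφ hz) ?_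
      simp only [hval]
      exact hρ'.comp (hns.comp hφ.tendsto_atTop)
    have hzr : z = xhat r := by
      have h3 := (h.isUniqueMinOn_fiber hta htb hz).1
      rw [hΦz] at h3
      exact (huniq r).2 z h3
    refine ⟨φ, ?_⟩
    rw [← hzr]
    exact (h.tendsto_min hφt hta htb hxφ hz).prodMk_nhds (h.tendsto_objective hφt hta htb hxφ hz)
  refine ⟨fun r h1 h2 => ?_, xhat, huniq, ?_, ?_⟩
  · have := h.minimizationWellPosed_fiber (hτa ⟨r, h1, h2⟩) (hτb _) (hmin _)
    rwa [hval] at this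
  -- Sequences suffice because the domain, a set of reals, is first countable; `Y` need not be.
  · exact continuous_iff_seqContinuous.2 fun ρ r hρ =>
      (continuous_fst.tendsto _).comp (hlim ρ r hρ)
  · exact continuous_iff_seqContinuous.2 fun ρ r hρ =>
      (continuous_snd.tendsto _).comp (hlim ρ r hρ)

end Pencil

/-- Sequences in a sequentially weakly closed subset of a reflexive space that are bounded in norm
have subsequences converging in this subset. -/
theorem Reflexive.exists_subseq_tendsto_subtype {E : Type*} [NormedAddCommGroup E]
    [NormedSpace ℝ E] (hE : Reflexive E) {X : Set (WeakSpace ℝ E)} (hX : IsSeqClosed X)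
    {B : Set E} (hB : Bornology.IsBounded B) (u : ℕ → X)
    (hu : ∀ n, (toWeakSpace ℝ E).symm (u n) ∈ B) :
    ∃ (x : X) (φ : ℕ → ℕ), StrictMono φ ∧ Tendsto (u ∘ φ) atTop (𝓝 x) := by
  obtain ⟨x, φ, hφ, hx⟩ := hE.exists_subseq_tendsto (u := fun n => (toWeakSpace ℝ E).symm (u n))
    (hB.subset (Set.range_subset_iff.2 hu))
  simp only [LinearEquiv.apply_symm_apply] at hx
  exact ⟨⟨x, hX (fun n => (u (φ n)).2) hx⟩, φ, hφ, tendsto_subtype_rng.2 hx⟩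

end SaddleWellPosed

theorem theorem4 {E : Type*} [NormedAddCommGroup E] [NormedSpace ℝ E] [CompleteSpace E]
    (hE : SaddleWellPosed.Reflexive E)
    (X : Set (WeakSpace ℝ E)) (hX : IsSeqClosed X)
    (J Φ : X → ℝ) (a b : EReal) (hab : a < b)
    (hαβ : SaddleWellPosed.alpha J Φ b < SaddleWellPosed.beta J Φ a)
    (hlsc : ∀ t : ℝ, a < (t : EReal) → (t : EReal) < b →
      SaddleWellPosed.SeqLowerSemicontinuous (fun x : X => J x + t * Φ x))
    (hbdd : ∀ t : ℝ, a < (t : EReal) → (t : EReal) < b → ∀ ρ : ℝ,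
      Bornology.IsBounded
        {e : E | ∃ h : toWeakSpace ℝ E e ∈ X,
          J ⟨toWeakSpace ℝ E e, h⟩ + t * Φ ⟨toWeakSpace ℝ E e, h⟩ ≤ ρ})
    (hmin : ∀ t : ℝ, a < (t : EReal) → (t : EReal) < b →
      ∃ x : X, SaddleWellPosed.IsUniqueMinOn (fun y : X => J y + t * Φ y) Set.univ x) :
    (∀ r : ℝ, SaddleWellPosed.alpha J Φ b < (r : EReal) →
      (r : EReal) < SaddleWellPosed.beta J Φ a →
      SaddleWellPosed.MinimizationWellPosed J (Φ ⁻¹' {r})) ∧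
    ∃ xhat : {r : ℝ // SaddleWellPosed.alpha J Φ b < (r : EReal) ∧
        (r : EReal) < SaddleWellPosed.beta J Φ a} → X,
      (∀ r, SaddleWellPosed.IsUniqueMinOn J (Φ ⁻¹' {r.val}) (xhat r)) ∧
      Continuous xhat ∧
      Continuous (fun r => J (xhat r)) := by
  have h : SaddleWellPosed.RegularPencil J Φ a b :=
    { lsc := hlsc
      exists_isUniqueMinOn := hmin
      exists_subseq_tendsto := fun t h1 h2 ρ u hu =>
        hE.exists_subseq_tendsto_subtype hX (hbdd t h1 h2 ρ) u fun n => ⟨(u n).2, hu n⟩ }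
  exact h.wellPosed hab
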